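/- Let $(B_t)_{t\ge 0}$ be a standard one-dimensional Brownian motion and let $f:[0,1]\to\mathbb{R}$ be a continuous function. For $h:[0,1]\to\mathbb{R}$ write $G_{[0,1]}(h)=\{(t,h(t)):t\in[0,1]\}\subset\mathbb{R}^2$ for its graph. For a non-empty bounded set $A\subset\mathbb{R}^d$ and $\epsilon>0$ let $P(A,\epsilon)$ be the maximum number of pairwise disjoint balls of radius $\epsilon$ with centers in $A$, and let $$\overline{\dim}_M(A)=\limsup_{\epsilon\to0}\frac{\log P(A,\epsilon)}{\log \epsilon^{-1}},\qquad \underline{\dim}_M(A)=\liminf_{\epsilon\to0}\frac{\log P(A,\epsilon)}{\log \epsilon^{-1}}$$ be its upper and lower Minkowski dimensions. Then, almost surely, $$\underline{\dim}_M G_{[0,1]}(B+f)=\max\{\underline{\dim}_M G_{[0,1]}(B),\ \underline{\dim}_M G_{[0,1]}(f)\},$$ $$\overline{\dim}_M G_{[0,1]}(B+f)=\max\{\overline{\dim}_M G_{[0,1]}(B),\ \overline{\dim}_M G_{[0,1]}(f)\},$$ and in the second equality $\overline{\dim}_M G_{[0,1]}(B)$ may be replaced by $\underline{\dim}_M G_{[0,1]}(B)$.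 -/

import Mathlib

open MeasureTheory ProbabilityTheory Filter Set Topology

/-- The packing number `P(A, ε)`: the largest number of points of `A` such that the balls of radius
`ε` around them are pairwise disjoint. It is `⊤` when there is no largest number, which does not
happen for bounded `A` and `ε > 0`. -/
noncomputable def ballPackingNumber {d : ℕ} (A : Set (EuclideanSpace ℝ (Fin d))) (ε : ℝ) : ℕ∞ :=
  ⨆ (S : Set (EuclideanSpace ℝ (Fin d))) (_ : S ⊆ A)
    (_ : S.PairwiseDisjoint fun x => Metric.ball x ε), S.encard

/-- The quotient `log P(A, ε) / log (1 / ε)`, as an extended real number. -/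
noncomputable def minkowskiQuotient {d : ℕ} (A : Set (EuclideanSpace ℝ (Fin d))) (ε : ℝ) : EReal :=
  ENNReal.log (ballPackingNumber A ε : ENNReal) / ((Real.log ε⁻¹ : ℝ) : EReal)

/-- The upper Minkowski (box) dimension of a set in `ℝᵈ`. -/
noncomputable def upperMinkowskiDim {d : ℕ} (A : Set (EuclideanSpace ℝ (Fin d))) : EReal :=
  limsup (fun ε : ℝ => minkowskiQuotient A ε) (𝓝[>] 0)

/-- The lower Minkowski (box) dimension of a set in `ℝᵈ`. -/
noncomputable def lowerMinkowskiDim {d : ℕ} (A : Set (EuclideanSpace ℝ (Fin d))) : EReal :=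
  liminf (fun ε : ℝ => minkowskiQuotient A ε) (𝓝[>] 0)

/-- The graph `{(t, h t) : t ∈ A}` of a real function over `A ⊆ ℝ`, as a subset of the Euclidean
plane. -/
def planeGraph (A : Set ℝ) (h : ℝ → ℝ) : Set (EuclideanSpace ℝ (Fin 2)) :=
  {p | ∃ t ∈ A, p = !₂[t, h t]}

/-!
The packing number of the graph of a continuous function `h` at scale `ε ≈ 2⁻ⁿ` is comparable with
the oscillation sum `oscSum h n`, the sum of `1 + 2ⁿ * osc h I` over the dyadic intervals `I` of
length `2⁻ⁿ` in `[0, 1]` (`exists_ballPackingNumber_eq`). Hence the Minkowski dimensions of the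
graph are the lower and upper growth exponents of the oscillation sums, and these sums are
subadditive in `h`. Since `B + f` is the sum of `B` and `f`, while `f` is the sum of `B + f` and
`-B`, the theorem follows (`minkowskiDim_add_eq_max`) once it is known that, almost surely,

* the upper dimension of the graph of `B` is at most `3 / 2`;
* the lower dimension of the graph of `B + f` is at least `3 / 2`, for each continuous `f`, and in
  particular for `f = 0`.

For the first fact, Gaussian tails and the Borel-Cantelli lemma bound the increments of `B` over
all dyadic intervals of large level, and chaining along dyadic approximations turns this into a
bound on the oscillations (`oscSum_le_of_dyadic_increments`). For the second, an increment of
`B + f` over an interval of length `2⁻ⁿ` is a Gaussian variable of standard deviation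
`2 ^ (-n / 2)` with a deterministic shift. As Gaussian densities are bounded, it is smaller than
`2 ^ (-(1 / 2 + η) n)` with probability at most `2 ^ (-η n)`, whatever the shift. By Markov's
inequality and the Borel-Cantelli lemma, less than half of the increments of level `n` are that
small when `n` is large (`ae_eventually_le_sum_abs_dyadicIncrement`). Independence of the increments
is not needed, since a loss of the factor `2 ^ (-η n)` does not affect the dimensions as `η` tends
to `0`.
-/

/-! ### Dyadic oscillation sums -/

/-- The closed dyadic interval `[i / 2ⁿ, (i + 1) / 2ⁿ]`. -/
def dyadicCell (n i : ℕ) : Set ℝ := Icc ((i : ℝ) / 2 ^ n) (((i : ℝ) + 1) / 2 ^ n)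

/-- The sum of `1 + 2ⁿ * osc h I` over the `2ⁿ` dyadic intervals `I ⊆ [0, 1]` of level `n`. Up to
constants, it is the number of squares of side `2⁻ⁿ` that the graph of a continuous `h` meets. -/
noncomputable def oscSum (h : ℝ → ℝ) (n : ℕ) : ℝ :=
  ∑ i ∈ Finset.range (2 ^ n), (1 + 2 ^ n * Metric.diam (h '' dyadicCell n i))

lemma dyadicCell_subset {n i : ℕ} (hi : i < 2 ^ n) : dyadicCell n i ⊆ Icc 0 1 := by
  have h : (i : ℝ) + 1 ≤ 2 ^ n := by exact_mod_cast hi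
  refine Icc_subset_Icc (by positivity) ?_
  rw [div_le_one (by positivity)]
  exact h

lemma left_mem_dyadicCell (n i : ℕ) : (i : ℝ) / 2 ^ n ∈ dyadicCell n i :=
  left_mem_Icc.2 (by gcongr; linarith)

lemma right_mem_dyadicCell (n i : ℕ) : ((i : ℝ) + 1) / 2 ^ n ∈ dyadicCell n i :=
  right_mem_Icc.2 (by gcongr; linarith)

lemma mem_dyadicCell_iff {n i : ℕ} {t : ℝ} :
    t ∈ dyadicCell n i ↔ (i : ℝ) ≤ 2 ^ n * t ∧ 2 ^ n * t ≤ i + 1 := by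
  rw [dyadicCell, mem_Icc, div_le_iff₀ (by positivity), le_div_iff₀ (by positivity), mul_comm]

lemma exists_mem_dyadicCell (n : ℕ) {t : ℝ} (ht : t ∈ Icc (0 : ℝ) 1) :
    ∃ i < 2 ^ n, t ∈ dyadicCell n i := by
  rcases ht.2.lt_or_eq with h1 | rfl
  · have h0 : 0 ≤ 2 ^ n * t := mul_nonneg (by positivity) ht.1
    refine ⟨⌊2 ^ n * t⌋₊, ?_, mem_dyadicCell_iff.2 ⟨Nat.floor_le h0, (Nat.lt_floor_add_one _).le⟩⟩
    rw [Nat.floor_lt h0]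
    push_cast
    nlinarith [show (0 : ℝ) < 2 ^ n by positivity]
  · have h : 1 ≤ 2 ^ n := Nat.one_le_two_pow
    refine ⟨2 ^ n - 1, by omega, mem_dyadicCell_iff.2 ?_⟩
    push_cast [Nat.cast_sub h]
    constructor <;> linarith

lemma isBounded_image_dyadicCell {h : ℝ → ℝ} (hh : ContinuousOn h (Icc 0 1)) {n i : ℕ}
    (hi : i < 2 ^ n) : Bornology.IsBounded (h '' dyadicCell n i) :=
  (isCompact_Icc.image_of_continuousOn (hh.mono (dyadicCell_subset hi))).isBounded

lemma abs_sub_le_diam_dyadicCell {h : ℝ → ℝ} (hh : ContinuousOn h (Icc 0 1)) {n i : ℕ}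
    (hi : i < 2 ^ n) {s t : ℝ} (hs : s ∈ dyadicCell n i) (ht : t ∈ dyadicCell n i) :
    |h s - h t| ≤ Metric.diam (h '' dyadicCell n i) :=
  Metric.dist_le_diam_of_mem (isBounded_image_dyadicCell hh hi) (mem_image_of_mem h hs)
    (mem_image_of_mem h ht)

lemma diam_image_dyadicCell_le {h : ℝ → ℝ} {n i : ℕ} {C : ℝ}
    (H : ∀ s ∈ dyadicCell n i, ∀ t ∈ dyadicCell n i, |h s - h t| ≤ C) :
    Metric.diam (h '' dyadicCell n i) ≤ C := by
  have hl := left_mem_dyadicCell n i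
  refine Metric.diam_le_of_forall_dist_le ((abs_nonneg _).trans (H _ hl _ hl)) ?_
  rintro _ ⟨s, hs, rfl⟩ _ ⟨t, ht, rfl⟩
  exact H s hs t ht

lemma two_pow_le_oscSum (h : ℝ → ℝ) (n : ℕ) : (2 : ℝ) ^ n ≤ oscSum h n := by
  have : ∑ i ∈ Finset.range (2 ^ n), (1 : ℝ) ≤ oscSum h n :=
    Finset.sum_le_sum fun i _ => le_add_of_nonneg_right (by positivity)
  simpa using this

lemma oscSum_pos (h : ℝ → ℝ) (n : ℕ) : 0 < oscSum h n :=
  lt_of_lt_of_le (by positivity) (two_pow_le_oscSum h n)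

/-- Oscillation sums are subadditive; with two of the three functions exchanged, this also bounds
the sum for a summand by the sum for the other summand and for the total. -/
lemma oscSum_le_add {u v w : ℝ → ℝ} (hu : ContinuousOn u (Icc 0 1))
    (hv : ContinuousOn v (Icc 0 1)) (H : ∀ s t, |w s - w t| ≤ |u s - u t| + |v s - v t|) (n : ℕ) :
    oscSum w n ≤ oscSum u n + oscSum v n := by
  rw [oscSum, oscSum, oscSum, ← Finset.sum_add_distrib]
  refine Finset.sum_le_sum fun i hi => ?_
  have hi := Finset.mem_range.1 hi
  have : Metric.diam (w '' dyadicCell n i) ≤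
      Metric.diam (u '' dyadicCell n i) + Metric.diam (v '' dyadicCell n i) :=
    diam_image_dyadicCell_le fun s hs t ht => (H s t).trans
      (add_le_add (abs_sub_le_diam_dyadicCell hu hi hs ht) (abs_sub_le_diam_dyadicCell hv hi hs ht))
  have h2 : (2 : ℝ) ^ n * Metric.diam (w '' dyadicCell n i) ≤ 2 ^ n *
      (Metric.diam (u '' dyadicCell n i) + Metric.diam (v '' dyadicCell n i)) := by gcongr
  linarith

/-! ### Packing numbers of graphs and oscillation sums -/

lemma dist_plane (a b c d : ℝ) :
    dist (!₂[a, b] : EuclideanSpace ℝ (Fin 2)) !₂[c, d] = √((a - c) ^ 2 + (b - d) ^ 2) := by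
  simp [EuclideanSpace.dist_eq, Real.dist_eq, sq_abs]

/-- A finite family of reals with gaps at least `1` and spread at most `L` has at most `L + 1`
members. -/
lemma card_le_of_separated {α : Type*} (F : Finset α) (z : α → ℝ) {L : ℝ} (hL : 0 ≤ L)
    (hsep : ∀ p ∈ F, ∀ q ∈ F, p ≠ q → 1 ≤ |z p - z q|)
    (hL' : ∀ p ∈ F, ∀ q ∈ F, |z p - z q| ≤ L) : (F.card : ℝ) ≤ L + 1 := by
  rcases F.eq_empty_or_nonempty with rfl | hF
  · simp; linarith
  obtain ⟨p₀, hp₀, hmin⟩ := F.exists_min_image z hF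
  have key : F.card ≤ (Finset.range (⌊L⌋₊ + 1)).card := by
    refine Finset.card_le_card_of_injOn (fun p => ⌊z p - z p₀⌋₊) (fun p hp => ?_) ?_
    · simp only [Finset.coe_range, mem_Iio, Nat.lt_succ_iff]
      exact Nat.floor_le_floor ((le_abs_self _).trans (hL' p hp p₀ hp₀))
    · intro p hp q hq hpq
      by_contra hne
      have h1 := hsep p hp q hq hne
      have hp1 := Nat.floor_le (sub_nonneg.2 (hmin p hp))
      have hp2 := Nat.lt_floor_add_one (z p - z p₀)
      have hq1 := Nat.floor_le (sub_nonneg.2 (hmin q hq))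
      have hq2 := Nat.lt_floor_add_one (z q - z p₀)
      simp only at hpq
      rw [hpq] at hp1 hp2
      have : |z p - z q| < 1 := by rw [abs_lt]; constructor <;> linarith
      linarith
  rw [Finset.card_range] at key
  calc (F.card : ℝ) ≤ ((⌊L⌋₊ + 1 : ℕ) : ℝ) := by exact_mod_cast key
    _ ≤ L + 1 := by push_cast; linarith [Nat.floor_le hL]

lemma two_mul_le_dist_of_pairwiseDisjoint {d : ℕ} {S : Set (EuclideanSpace ℝ (Fin d))} {ε : ℝ}
    (hε : 0 < ε) (hS : S.PairwiseDisjoint fun x => Metric.ball x ε)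
    {p q : EuclideanSpace ℝ (Fin d)} (hp : p ∈ S) (hq : q ∈ S) (hpq : p ≠ q) :
    2 * ε ≤ dist p q := by
  have := (disjoint_ball_ball_iff hε hε).1 (hS hp hq hpq)
  linarith

/-- Two points of a packing by balls of radius at least `2⁻ⁿ` that lie over the same dyadic interval
of level `n` have heights that differ by at least `2⁻ⁿ`, which bounds the number of points over each
interval. -/
lemma card_le_oscSum {h : ℝ → ℝ} (hh : ContinuousOn h (Icc 0 1)) {n : ℕ} {ε : ℝ} (hε : 0 < ε)
    (hn : 1 ≤ 2 ^ n * ε) (T : Finset (EuclideanSpace ℝ (Fin 2)))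
    (hT : (T : Set (EuclideanSpace ℝ (Fin 2))) ⊆ planeGraph (Icc 0 1) h)
    (hd : (T : Set (EuclideanSpace ℝ (Fin 2))).PairwiseDisjoint fun x => Metric.ball x ε) :
    (T.card : ℝ) ≤ oscSum h n := by
  classical
  have hN : (0 : ℝ) < 2 ^ n := by positivity
  have hcov : T ⊆ (Finset.range (2 ^ n)).biUnion fun i =>
      T.filter fun p => p 0 ∈ dyadicCell n i := by
    intro p hp
    obtain ⟨t, ht, rfl⟩ := hT hp
    obtain ⟨i, hi, hti⟩ := exists_mem_dyadicCell n ht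
    simp only [Finset.mem_biUnion, Finset.mem_filter, Finset.mem_range]
    exact ⟨i, hi, hp, by simpa using hti⟩
  have hfib : ∀ i ∈ Finset.range (2 ^ n), ((T.filter fun p => p 0 ∈ dyadicCell n i).card : ℝ) ≤
      1 + 2 ^ n * Metric.diam (h '' dyadicCell n i) := by
    intro i hi
    have hi := Finset.mem_range.1 hi
    rw [add_comm]
    refine card_le_of_separated _ (fun p => 2 ^ n * p 1) (by positivity) ?_ ?_
    · intro p hp q hq hpq
      simp only [Finset.mem_filter] at hp hq
      have hdist := two_mul_le_dist_of_pairwiseDisjoint hε hd hp.1 hq.1 hpq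
      obtain ⟨s, hs, rfl⟩ := hT hp.1
      obtain ⟨t, ht, rfl⟩ := hT hq.1
      rw [dist_plane, Real.le_sqrt' (by positivity)] at hdist
      have h1 := mem_dyadicCell_iff.1 hp.2
      have h2 := mem_dyadicCell_iff.1 hq.2
      simp only [Matrix.cons_val_zero, Matrix.cons_val_one] at h1 h2 ⊢
      rw [← mul_sub, abs_mul, abs_of_pos hN]
      have hx : |2 ^ n * (s - t)| ≤ 1 := by rw [abs_le]; constructor <;> nlinarith
      have hx2 : (2 ^ n * (s - t)) ^ 2 ≤ 1 := by
        rw [← sq_abs]; nlinarith [abs_nonneg (2 ^ n * (s - t))]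
      have hy2 : (2 : ℝ) ^ 2 ≤ (2 ^ n * (s - t)) ^ 2 + (2 ^ n * (h s - h t)) ^ 2 := by
        calc (2 : ℝ) ^ 2 ≤ (2 * (2 ^ n * ε)) ^ 2 := by
              refine pow_le_pow_left₀ (by norm_num) (by linarith) 2
          _ = (2 ^ n) ^ 2 * (2 * ε) ^ 2 := by ring
          _ ≤ (2 ^ n) ^ 2 * ((s - t) ^ 2 + (h s - h t) ^ 2) := by gcongr
          _ = _ := by ring
      have : 1 ≤ |2 ^ n * (h s - h t)| := by
        rw [← one_le_sq_iff₀ (abs_nonneg _), sq_abs]; linarith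
      rwa [abs_mul, abs_of_pos hN] at this
    · intro p hp q hq
      simp only [Finset.mem_filter] at hp hq
      obtain ⟨s, hs, rfl⟩ := hT hp.1
      obtain ⟨t, ht, rfl⟩ := hT hq.1
      have h1 := hp.2
      have h2 := hq.2
      simp only [Matrix.cons_val_zero, Matrix.cons_val_one] at h1 h2 ⊢
      rw [← mul_sub, abs_mul, abs_of_pos hN]
      gcongr
      exact abs_sub_le_diam_dyadicCell hh hi h1 h2
  calc (T.card : ℝ) ≤ ∑ i ∈ Finset.range (2 ^ n),
        ((T.filter fun p => p 0 ∈ dyadicCell n i).card : ℝ) := by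
        exact_mod_cast (Finset.card_le_card hcov).trans Finset.card_biUnion_le
    _ ≤ oscSum h n := Finset.sum_le_sum hfib

/-- The packing number of the graph of a continuous function is attained, and a packing that attains
it is maximal, so that the balls of twice the radius cover the graph. -/
lemma exists_maximal_packing {h : ℝ → ℝ} (hh : ContinuousOn h (Icc 0 1)) {n : ℕ} {ε : ℝ}
    (hε : 0 < ε) (hn : 1 ≤ 2 ^ n * ε) :
    ∃ T : Finset (EuclideanSpace ℝ (Fin 2)),
      ballPackingNumber (planeGraph (Icc 0 1) h) ε = T.card ∧ (T.card : ℝ) ≤ oscSum h n ∧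
      ∀ t ∈ Icc (0 : ℝ) 1, ∃ p ∈ T, dist !₂[t, h t] p < 2 * ε := by
  classical
  let A := planeGraph (Icc 0 1) h
  let Q : Finset (EuclideanSpace ℝ (Fin 2)) → Prop := fun T =>
    (T : Set (EuclideanSpace ℝ (Fin 2))) ⊆ A ∧
      (T : Set (EuclideanSpace ℝ (Fin 2))).PairwiseDisjoint fun x => Metric.ball x ε
  have hbound : ∀ T, Q T → T.card ≤ ⌊oscSum h n⌋₊ := fun T hT =>
    Nat.le_floor (card_le_oscSum hh hε hn T hT.1 hT.2)
  -- a packing with the largest possible number of points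
  obtain ⟨T, hT, hmax⟩ : ∃ T, Q T ∧ ∀ T', Q T' → T'.card ≤ T.card := by
    have hne : {k | ∃ T, Q T ∧ T.card = k}.Nonempty := ⟨0, ∅, by simp [Q], rfl⟩
    have hbdd : BddAbove {k | ∃ T, Q T ∧ T.card = k} :=
      ⟨⌊oscSum h n⌋₊, by rintro _ ⟨T, hT, rfl⟩; exact hbound T hT⟩
    obtain ⟨T, hT, hk⟩ := Nat.sSup_mem hne hbdd
    exact ⟨T, hT, fun T' hT' => hk ▸ le_csSup hbdd ⟨T', hT', rfl⟩⟩
  refine ⟨T, le_antisymm ?_ ?_, card_le_oscSum hh hε hn T hT.1 hT.2, fun t ht => ?_⟩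
  · refine iSup_le fun S => iSup_le fun hS => iSup_le fun hdS => ?_
    by_contra hlt
    rw [not_le] at hlt
    obtain ⟨S', hS', hcard⟩ := Set.exists_subset_encard_eq (Order.add_one_le_of_lt hlt)
    have hfin : S'.Finite := Set.finite_of_encard_eq_coe (k := T.card + 1) (by simpa using hcard)
    lift S' to Finset (EuclideanSpace ℝ (Fin 2)) using hfin
    rw [Set.encard_coe_eq_coe_finsetCard] at hcard
    have := hmax S' ⟨hS'.trans hS, hdS.subset hS'⟩
    have h2 : S'.card = T.card + 1 := by exact_mod_cast hcard
    omega
  · rw [← Set.encard_coe_eq_coe_finsetCard]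
    exact le_iSup_of_le (T : Set _) (le_iSup_of_le hT.1 (le_iSup_of_le hT.2 le_rfl))
  · by_contra! hfar
    set p : EuclideanSpace ℝ (Fin 2) := !₂[t, h t] with hp
    have hpT : p ∉ T := fun hpT => by
      have := hfar p hpT
      rw [dist_self] at this
      linarith
    have hQ : Q (insert p T) := by
      constructor
      · rw [Finset.coe_insert, insert_subset_iff]
        exact ⟨⟨t, ht, rfl⟩, hT.1⟩
      · rw [Finset.coe_insert]
        refine hT.2.insert fun q hq _ => ?_
        exact (disjoint_ball_ball_iff hε hε).2 (by linarith [hfar q hq])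
    have := hmax _ hQ
    rw [Finset.card_insert_of_notMem hpT] at this
    omega

/-- If intervals of radius `ρ` around finitely many points cover a connected image, then any
two of its values differ by at most `2ρ` times the number of points. -/
lemma abs_sub_le_of_cover {α : Type*} {h : ℝ → ℝ} {s t : ℝ} (hh : ContinuousOn h (uIcc s t))
    (F : Finset α) (y : α → ℝ) {ρ : ℝ} (hρ : 0 ≤ ρ)
    (H : ∀ x ∈ uIcc s t, ∃ p ∈ F, |h x - y p| ≤ ρ) : |h s - h t| ≤ 2 * ρ * F.card := by
  have hsub : uIcc (h s) (h t) ⊆ ⋃ p ∈ F, Metric.closedBall (y p) ρ := by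
    refine (intermediate_value_uIcc hh).trans ?_
    rintro _ ⟨x, hx, rfl⟩
    obtain ⟨p, hp, hxp⟩ := H x hx
    exact mem_iUnion₂.2 ⟨p, hp, by rwa [Metric.mem_closedBall, Real.dist_eq]⟩
  have hvol : volume (uIcc (h s) (h t)) ≤ ENNReal.ofReal (2 * ρ * F.card) :=
    calc volume (uIcc (h s) (h t)) ≤ volume (⋃ p ∈ F, Metric.closedBall (y p) ρ) :=
          measure_mono hsub
      _ ≤ ∑ p ∈ F, volume (Metric.closedBall (y p) ρ) := measure_biUnion_finset_le _ _
      _ = ENNReal.ofReal (2 * ρ * F.card) := by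
          simp only [Real.volume_closedBall, Finset.sum_const, nsmul_eq_mul]
          rw [ENNReal.ofReal_mul (p := 2 * ρ) (by positivity), ENNReal.ofReal_natCast, mul_comm]
  rw [Real.volume_interval, ENNReal.ofReal_le_ofReal_iff (by positivity)] at hvol
  rwa [abs_sub_comm]

/-- Only the points of a maximal packing over the nine nearest columns are needed to cover the part
of the graph over a dyadic interval. -/
lemma oscSum_le_card {h : ℝ → ℝ} (hh : ContinuousOn h (Icc 0 1)) {n : ℕ} {ε : ℝ} (hε : 0 < ε)
    (hn : 2 ^ n * ε ≤ 2) (T : Finset (EuclideanSpace ℝ (Fin 2)))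
    (hT : ∀ t ∈ Icc (0 : ℝ) 1, ∃ p ∈ T, dist !₂[t, h t] p < 2 * ε) :
    oscSum h n ≤ 81 * T.card := by
  classical
  have hN : (0 : ℝ) < 2 ^ n := by positivity
  let W : ℕ → Finset (EuclideanSpace ℝ (Fin 2)) := fun i =>
    T.filter fun p => ⌊2 ^ n * p 0⌋ ∈ Finset.Icc ((i : ℤ) - 4) (i + 4)
  have hcov : ∀ i < 2 ^ n, ∀ t ∈ dyadicCell n i, ∃ p ∈ W i, |h t - p 1| ≤ 2 * ε := by
    intro i hi t ht
    obtain ⟨p, hp, hd⟩ := hT t (dyadicCell_subset hi ht)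
    have h0 : |t - p 0| < 2 * ε := by
      have := PiLp.dist_apply_le (p := 2) !₂[t, h t] p 0
      simp only [Matrix.cons_val_zero, Real.dist_eq] at this
      linarith
    have h1 : |h t - p 1| < 2 * ε := by
      have := PiLp.dist_apply_le (p := 2) !₂[t, h t] p 1
      simp only [Matrix.cons_val_one, Matrix.cons_val_fin_one, Real.dist_eq] at this
      linarith
    refine ⟨p, ?_, h1.le⟩
    have ht' := mem_dyadicCell_iff.1 ht
    have h2 := abs_lt.1 h0
    simp only [W, Finset.mem_filter, Finset.mem_Icc]
    refine ⟨hp, ?_, ?_⟩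
    · rw [Int.le_floor]; push_cast; nlinarith
    · rw [← Int.lt_add_one_iff, Int.floor_lt]; push_cast; nlinarith
  have hterm : ∀ i ∈ Finset.range (2 ^ n), 1 + 2 ^ n * Metric.diam (h '' dyadicCell n i) ≤
      9 * ((W i).card : ℝ) := by
    intro i hi
    have hi := Finset.mem_range.1 hi
    have h1 : (1 : ℝ) ≤ (W i).card := by
      obtain ⟨p, hp, -⟩ := hcov i hi _ (left_mem_dyadicCell n i)
      exact_mod_cast Finset.card_pos.2 ⟨p, hp⟩
    have h2 : Metric.diam (h '' dyadicCell n i) ≤ 2 * (2 * ε) * (W i).card := by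
      refine diam_image_dyadicCell_le fun s hs t ht => ?_
      have hst : uIcc s t ⊆ dyadicCell n i := uIcc_subset_Icc hs ht
      exact abs_sub_le_of_cover (hh.mono (hst.trans (dyadicCell_subset hi))) (W i) (fun p => p 1)
        (by positivity) fun x hx => hcov i hi x (hst hx)
    have h3 : 2 ^ n * Metric.diam (h '' dyadicCell n i) ≤ 8 * (W i).card :=
      calc 2 ^ n * Metric.diam (h '' dyadicCell n i) ≤
            2 ^ n * (2 * (2 * ε) * (W i).card) := by gcongr
        _ = 4 * (2 ^ n * ε) * (W i).card := by ring
        _ ≤ 8 * (W i).card := by gcongr; linarith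
    linarith
  have hcount : ∑ i ∈ Finset.range (2 ^ n), (W i).card ≤ 9 * T.card := by
    simp only [W, Finset.card_filter]
    rw [Finset.sum_comm]
    simp only [← Finset.card_filter]
    rw [mul_comm, ← smul_eq_mul]
    refine Finset.sum_le_card_nsmul _ _ _ fun p _ => ?_
    calc _ ≤ (Finset.Icc (⌊2 ^ n * p 0⌋ - 4) (⌊2 ^ n * p 0⌋ + 4)).card := by
          refine Finset.card_le_card_of_injOn (fun i : ℕ => (i : ℤ)) (fun i hi => ?_)
            Nat.cast_injective.injOn
          simp only [Finset.coe_filter, Finset.mem_Icc, mem_ofPred_eq, Finset.coe_Icc,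
            mem_Icc] at hi ⊢
          omega
      _ = 9 := by rw [Int.card_Icc]; omega
  calc oscSum h n ≤ ∑ i ∈ Finset.range (2 ^ n), 9 * ((W i).card : ℝ) := Finset.sum_le_sum hterm
    _ = 9 * ((∑ i ∈ Finset.range (2 ^ n), (W i).card : ℕ) : ℝ) := by
        rw [← Finset.mul_sum]; push_cast; rfl
    _ ≤ 9 * ((9 * T.card : ℕ) : ℝ) := by gcongr
    _ = 81 * T.card := by push_cast; ring

/-- At a scale comparable with `2⁻ⁿ`, the packing number of the graph is comparable with the
oscillation sum of level `n`. -/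
lemma exists_ballPackingNumber_eq {h : ℝ → ℝ} (hh : ContinuousOn h (Icc 0 1)) {ε : ℝ}
    (hε : 0 < ε) {n : ℕ} (hn : 1 ≤ 2 ^ n * ε) (hn' : 2 ^ n * ε ≤ 2) :
    ∃ k : ℕ, ballPackingNumber (planeGraph (Icc 0 1) h) ε = k ∧ (k : ℝ) ≤ oscSum h n ∧
      oscSum h n ≤ 81 * k := by
  obtain ⟨T, h1, h2, h3⟩ := exists_maximal_packing hh hε hn
  exact ⟨T.card, h1, h2, oscSum_le_card hh hε hn' T h3⟩

/-! ### Chaining -/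

lemma abs_sub_left_le_of_dyadic_increments {b : ℝ → ℝ} (hb : ContinuousOn b (Icc 0 1)) {r : ℝ}
    (hr0 : 0 < r) (hr1 : r < 1) {n : ℕ}
    (H : ∀ m ≥ n, ∀ i : ℕ, i < 2 ^ m →
      |b (((i : ℝ) + 1) / 2 ^ m) - b ((i : ℝ) / 2 ^ m)| ≤ r ^ m)
    {i : ℕ} (hi : i < 2 ^ n) {t : ℝ} (ht : t ∈ dyadicCell n i) :
    |b ((i : ℝ) / 2 ^ n) - b t| ≤ r ^ n / (1 - r) := by
  have ht01 := dyadicCell_subset hi ht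
  rw [mem_dyadicCell_iff] at ht
  have hrn : 0 < r ^ n := by positivity
  rcases ht.2.eq_or_lt with heq | hlt
  · have : t = ((i : ℝ) + 1) / 2 ^ n := by rw [eq_div_iff (by positivity), mul_comm]; exact heq
    rw [this, abs_sub_comm]
    refine (H n le_rfl i hi).trans ?_
    rw [le_div_iff₀ (by linarith)]
    nlinarith
  have ht0 := ht01.1
  have ht1 : t < 1 := by
    have : (i : ℝ) + 1 ≤ 2 ^ n := by exact_mod_cast hi
    nlinarith [show (0 : ℝ) < 2 ^ n by positivity]
  -- the left dyadic approximations of `t`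
  let a : ℕ → ℕ := fun m => ⌊2 ^ m * t⌋₊
  have ha0 : ∀ m, (a m : ℝ) ≤ 2 ^ m * t := fun m => Nat.floor_le (by positivity)
  have ha1 : ∀ m, 2 ^ m * t < a m + 1 := fun m => Nat.lt_floor_add_one _
  have han : a n = i := (Nat.floor_eq_iff (by positivity)).2 ⟨ht.1, hlt⟩
  have hstep : ∀ m, a (m + 1) = 2 * a m ∨ a (m + 1) = 2 * a m + 1 := by
    intro m
    have h1 := ha0 m
    have h2 := ha1 m
    have h3 := ha0 (m + 1)
    have h4 := ha1 (m + 1)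
    rw [pow_succ] at h3 h4
    have h5 : (2 * a m : ℝ) < a (m + 1) + 1 := by linarith
    have h6 : (a (m + 1) : ℝ) < 2 * a m + 2 := by linarith
    have h5' : 2 * a m < a (m + 1) + 1 := by exact_mod_cast h5
    have h6' : a (m + 1) < 2 * a m + 2 := by exact_mod_cast h6
    omega
  have hlim : Tendsto (fun m => (a (n + m) : ℝ) / 2 ^ (n + m)) atTop (𝓝 t) := by
    have hz : Tendsto (fun m : ℕ => t - (1 / 2 : ℝ) ^ (n + m)) atTop (𝓝 t) := by
      have := (tendsto_pow_atTop_nhds_zero_of_lt_one (by norm_num : (0 : ℝ) ≤ 1 / 2)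
        (by norm_num)).comp (tendsto_add_atTop_nat n)
      simpa [add_comm] using this.const_sub t
    refine tendsto_of_tendsto_of_tendsto_of_le_of_le hz tendsto_const_nhds (fun m => ?_)
      fun m => ?_
    · simp only [one_div, inv_pow]
      rw [le_div_iff₀ (by positivity), sub_mul, inv_mul_cancel₀ (by positivity), mul_comm]
      linarith [ha1 (n + m)]
    · simp only
      rw [div_le_iff₀ (by positivity), mul_comm]
      exact ha0 _
  have hmem : ∀ m, (a m : ℝ) / 2 ^ m ∈ Icc (0 : ℝ) 1 := by
    refine fun m => ⟨by positivity, ?_⟩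
    rw [div_le_one (by positivity)]
    nlinarith [ha0 m, show (0 : ℝ) < 2 ^ m by positivity]
  have hblim : Tendsto (fun m => b ((a (n + m) : ℝ) / 2 ^ (n + m))) atTop (𝓝 (b t)) :=
    ((hb t ht01).tendsto).comp
      (tendsto_nhdsWithin_iff.2 ⟨hlim, Eventually.of_forall fun m => hmem _⟩)
  have hdist : ∀ m, dist (b ((a (n + m) : ℝ) / 2 ^ (n + m)))
      (b ((a (n + (m + 1)) : ℝ) / 2 ^ (n + (m + 1)))) ≤ r ^ n * r ^ m := by
    intro m
    have hle : r ^ (n + m + 1) ≤ r ^ n * r ^ m := by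
      rw [← pow_add]; exact pow_le_pow_of_le_one hr0.le hr1.le (by omega)
    rw [← add_assoc, dist_comm, Real.dist_eq]
    have hhalf : (a (n + m) : ℝ) / 2 ^ (n + m) = ((2 * a (n + m) : ℕ) : ℝ) / 2 ^ (n + m + 1) := by
      push_cast; rw [pow_succ]; field_simp
    rw [hhalf]
    rcases hstep (n + m) with h | h
    · rw [h, sub_self, abs_zero]; positivity
    · have hlt' : 2 * a (n + m) < 2 ^ (n + m + 1) := by
        have : (a (n + m) : ℝ) < 2 ^ (n + m) := by
          nlinarith [ha0 (n + m), show (0 : ℝ) < 2 ^ (n + m) by positivity]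
        have : a (n + m) < 2 ^ (n + m) := by exact_mod_cast this
        rw [pow_succ]; omega
      have := H (n + m + 1) (by omega) _ hlt'
      rw [h]
      push_cast at this ⊢
      exact this.trans hle
  have := dist_le_of_le_geometric_of_tendsto₀ r (r ^ n) hr1 hdist hblim
  rwa [add_zero, han, Real.dist_eq] at this

/-- If the increments of a continuous function over the dyadic intervals of every level `m ≥ n` are
at most `rᵐ`, then its oscillation over an interval of level `n` is of order `rⁿ`. -/
lemma oscSum_le_of_dyadic_increments {b : ℝ → ℝ} (hb : ContinuousOn b (Icc 0 1)) {r : ℝ}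
    (hr0 : 1 / 2 ≤ r) (hr1 : r < 1) {n : ℕ}
    (H : ∀ m ≥ n, ∀ i : ℕ, i < 2 ^ m →
      |b (((i : ℝ) + 1) / 2 ^ m) - b ((i : ℝ) / 2 ^ m)| ≤ r ^ m) :
    oscSum b n ≤ (1 + 2 / (1 - r)) * (4 * r) ^ n := by
  have h1r : 0 < 1 - r := by linarith
  have hr : 0 < r := by linarith
  have hd : ∀ i ∈ Finset.range (2 ^ n), 1 + 2 ^ n * Metric.diam (b '' dyadicCell n i) ≤
      1 + 2 ^ n * (2 * (r ^ n / (1 - r))) := by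
    intro i hi
    have hi := Finset.mem_range.1 hi
    gcongr
    refine diam_image_dyadicCell_le fun s hs t ht => ?_
    have h1 := abs_sub_left_le_of_dyadic_increments hb hr hr1 H hi hs
    have h2 := abs_sub_left_le_of_dyadic_increments hb hr hr1 H hi ht
    rw [abs_sub_comm] at h1
    linarith [abs_sub_le (b s) (b ((i : ℝ) / 2 ^ n)) (b t)]
  have h2 : (2 : ℝ) ^ n ≤ (4 * r) ^ n := pow_le_pow_left₀ (by norm_num) (by linarith) n
  calc oscSum b n ≤ ∑ i ∈ Finset.range (2 ^ n), (1 + 2 ^ n * (2 * (r ^ n / (1 - r)))) :=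
        Finset.sum_le_sum hd
    _ = 2 ^ n + 2 / (1 - r) * (2 ^ n * 2 ^ n * r ^ n) := by
        rw [Finset.sum_const, Finset.card_range, nsmul_eq_mul]; push_cast; ring
    _ = 2 ^ n + 2 / (1 - r) * (4 * r) ^ n := by
        rw [mul_pow, ← mul_pow 2 2 n]; norm_num
    _ ≤ (1 + 2 / (1 - r)) * (4 * r) ^ n := by linarith

lemma sum_abs_increments_le_oscSum {b : ℝ → ℝ} (hb : ContinuousOn b (Icc 0 1)) (n : ℕ) :
    2 ^ n * ∑ i ∈ Finset.range (2 ^ n), |b (((i : ℝ) + 1) / 2 ^ n) - b ((i : ℝ) / 2 ^ n)| ≤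
      oscSum b n := by
  rw [Finset.mul_sum]
  refine Finset.sum_le_sum fun i hi => ?_
  have := abs_sub_le_diam_dyadicCell hb (Finset.mem_range.1 hi) (right_mem_dyadicCell n i)
    (left_mem_dyadicCell n i)
  have h2 : (2 : ℝ) ^ n * |b (((i : ℝ) + 1) / 2 ^ n) - b ((i : ℝ) / 2 ^ n)| ≤
    2 ^ n * Metric.diam (b '' dyadicCell n i) := by gcongr
  linarith

/-! ### Limits inferior and superior up to vanishing errors -/

lemma limsup_le_limsup_of_le_add {α : Type*} {F : Filter α} [F.NeBot] {u v : α → EReal} {e : α → ℝ}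
    (he : Tendsto e F (𝓝 0)) (H : ∀ᶠ x in F, u x ≤ v x + (e x : EReal)) :
    limsup u F ≤ limsup v F := by
  have hl : limsup (fun x => (e x : EReal)) F = 0 :=
    (continuous_coe_real_ereal.tendsto' 0 0 (by simp) |>.comp he).limsup_eq
  calc limsup u F ≤ limsup (v + fun x => (e x : EReal)) F := limsup_le_limsup H
    _ ≤ limsup v F + limsup (fun x => (e x : EReal)) F :=
        EReal.limsup_add_le (.inr (by simp [hl])) (.inr (by simp [hl]))
    _ = limsup v F := by rw [hl, add_zero]

lemma liminf_le_liminf_of_le_add {α : Type*} {F : Filter α} [F.NeBot] {u v : α → EReal} {e : α → ℝ}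
    (he : Tendsto e F (𝓝 0)) (H : ∀ᶠ x in F, u x ≤ v x + (e x : EReal)) :
    liminf u F ≤ liminf v F := by
  have hl : limsup (fun x => (e x : EReal)) F = 0 :=
    (continuous_coe_real_ereal.tendsto' 0 0 (by simp) |>.comp he).limsup_eq
  calc liminf u F ≤ liminf ((fun x => (e x : EReal)) + v) F :=
        liminf_le_liminf (H.mono fun x hx => by rw [Pi.add_apply, add_comm]; exact hx)
    _ ≤ limsup (fun x => (e x : EReal)) F + liminf v F :=
        EReal.liminf_add_le (.inl (by simp [hl])) (.inl (by simp [hl]))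
    _ = liminf v F := by rw [hl, zero_add]

lemma liminf_max_le {α : Type*} {F : Filter α} (u v : α → EReal) :
    liminf (fun x => max (u x) (v x)) F ≤ max (limsup u F) (liminf v F) := by
  refine le_of_forall_gt_imp_ge_of_dense fun c hc => ?_
  obtain ⟨hu, hv⟩ := max_lt_iff.1 hc
  refine liminf_le_of_frequently_le ?_
  exact ((frequently_lt_of_liminf_lt (by isBoundedDefault) hv).and_eventually
    (eventually_lt_of_limsup_lt hu)).mono fun x hx => max_le hx.2.le hx.1.le

/-! ### Minkowski dimensions of graphs as growth exponents of oscillation sums -/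

/-- The level of the dyadic intervals whose length is comparable with `ε`. -/
noncomputable def dyadicLevel (ε : ℝ) : ℕ := ⌈Real.logb 2 ε⁻¹⌉₊

lemma inv_le_two_pow_dyadicLevel {ε : ℝ} (h0 : 0 < ε) : ε⁻¹ ≤ 2 ^ dyadicLevel ε := by
  rw [← Real.rpow_natCast, ← Real.logb_le_iff_le_rpow (by norm_num) (by positivity)]
  exact Nat.le_ceil _

lemma two_pow_dyadicLevel_le {ε : ℝ} (h0 : 0 < ε) (h1 : ε < 1) :
    2 ^ dyadicLevel ε ≤ 2 * ε⁻¹ := by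
  have h : 0 ≤ Real.logb 2 ε⁻¹ := Real.logb_nonneg (by norm_num) ((one_le_inv₀ h0).2 h1.le)
  calc (2 : ℝ) ^ dyadicLevel ε = 2 ^ (dyadicLevel ε : ℝ) := (Real.rpow_natCast _ _).symm
    _ ≤ 2 ^ (Real.logb 2 ε⁻¹ + 1) :=
        Real.rpow_le_rpow_of_exponent_le (by norm_num) (Nat.ceil_lt_add_one h).le
    _ = 2 * ε⁻¹ := by
        rw [Real.rpow_add (by norm_num), Real.rpow_logb (by norm_num) (by norm_num) (by positivity)]
        ring

lemma tendsto_log_inv : Tendsto (fun ε : ℝ => Real.log ε⁻¹) (𝓝[>] 0) atTop :=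
  Real.tendsto_log_atTop.comp tendsto_inv_nhdsGT_zero

lemma tendsto_const_div_log_inv (C : ℝ) :
    Tendsto (fun ε : ℝ => C / Real.log ε⁻¹) (𝓝[>] 0) (𝓝 0) :=
  tendsto_log_inv.const_div_atTop C

lemma tendsto_dyadicLevel : Tendsto dyadicLevel (𝓝[>] 0) atTop :=
  tendsto_nat_ceil_atTop.comp (tendsto_log_inv.atTop_div_const (Real.log_pos one_lt_two))

lemma eventually_small : ∀ᶠ ε : ℝ in 𝓝[>] 0, 0 < ε ∧ ε < 1 ∧ 0 < Real.log ε⁻¹ := by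
  filter_upwards [Ioo_mem_nhdsGT one_pos] with ε hε
  exact ⟨hε.1, hε.2, Real.log_pos ((one_lt_inv₀ hε.1).2 hε.2)⟩

/-- The analogue of `minkowskiQuotient` for the graph of `h` with the oscillation sum in place of
the packing number. -/
noncomputable def oscQuotient (h : ℝ → ℝ) (ε : ℝ) : ℝ :=
  Real.log (oscSum h (dyadicLevel ε)) / Real.log ε⁻¹

lemma minkowskiQuotient_bounds {h : ℝ → ℝ} (hh : ContinuousOn h (Icc 0 1)) {ε : ℝ} (h0 : 0 < ε)
    (h1 : ε < 1) (hl : 0 < Real.log ε⁻¹) :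
    minkowskiQuotient (planeGraph (Icc 0 1) h) ε ≤ oscQuotient h ε ∧
    (oscQuotient h ε : EReal) ≤ minkowskiQuotient (planeGraph (Icc 0 1) h) ε +
      ((Real.log 81 / Real.log ε⁻¹ : ℝ) : EReal) := by
  obtain ⟨k, hk, hk1, hk2⟩ := exists_ballPackingNumber_eq hh h0 (n := dyadicLevel ε)
    (by rw [← inv_le_iff_one_le_mul₀ h0]; exact inv_le_two_pow_dyadicLevel h0)
    (by rw [← le_div_iff₀ h0]; exact two_pow_dyadicLevel_le h0 h1)
  have hpos := oscSum_pos h (dyadicLevel ε)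
  have hk0 : (0 : ℝ) < k := by linarith
  have hQ : minkowskiQuotient (planeGraph (Icc 0 1) h) ε =
      ((Real.log k / Real.log ε⁻¹ : ℝ) : EReal) := by
    rw [minkowskiQuotient, hk, EReal.coe_div, ← ENNReal.log_ofReal_of_pos hk0]
    simp
  rw [hQ, oscQuotient, ← EReal.coe_add, EReal.coe_le_coe_iff, EReal.coe_le_coe_iff, ← add_div]
  constructor
  · gcongr
  · rw [← Real.log_mul hk0.ne' (by norm_num), mul_comm]
    gcongr

lemma upperMinkowskiDim_eq {h : ℝ → ℝ} (hh : ContinuousOn h (Icc 0 1)) :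
    upperMinkowskiDim (planeGraph (Icc 0 1) h) =
      limsup (fun ε => (oscQuotient h ε : EReal)) (𝓝[>] 0) := by
  refine le_antisymm (limsup_le_limsup ?_)
    (limsup_le_limsup_of_le_add (tendsto_const_div_log_inv (Real.log 81)) ?_) <;>
  filter_upwards [eventually_small] with ε hε
  · exact (minkowskiQuotient_bounds hh hε.1 hε.2.1 hε.2.2).1
  · exact (minkowskiQuotient_bounds hh hε.1 hε.2.1 hε.2.2).2

lemma lowerMinkowskiDim_eq {h : ℝ → ℝ} (hh : ContinuousOn h (Icc 0 1)) :
    lowerMinkowskiDim (planeGraph (Icc 0 1) h) =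
      liminf (fun ε => (oscQuotient h ε : EReal)) (𝓝[>] 0) := by
  refine le_antisymm (liminf_le_liminf ?_)
    (liminf_le_liminf_of_le_add (tendsto_const_div_log_inv (Real.log 81)) ?_) <;>
  filter_upwards [eventually_small] with ε hε
  · exact (minkowskiQuotient_bounds hh hε.1 hε.2.1 hε.2.2).1
  · exact (minkowskiQuotient_bounds hh hε.1 hε.2.1 hε.2.2).2

lemma lowerMinkowskiDim_le_upperMinkowskiDim {d : ℕ} (A : Set (EuclideanSpace ℝ (Fin d))) :
    lowerMinkowskiDim A ≤ upperMinkowskiDim A :=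
  liminf_le_limsup

lemma eventually_oscQuotient_le {u v w : ℝ → ℝ} (hu : ContinuousOn u (Icc 0 1))
    (hv : ContinuousOn v (Icc 0 1)) (H : ∀ s t, |w s - w t| ≤ |u s - u t| + |v s - v t|) :
    ∀ᶠ ε in 𝓝[>] 0, (oscQuotient w ε : EReal) ≤
      max (oscQuotient u ε : EReal) (oscQuotient v ε) +
        ((Real.log 2 / Real.log ε⁻¹ : ℝ) : EReal) := by
  filter_upwards [eventually_small] with ε hε
  have hl := hε.2.2
  rw [← EReal.coe_strictMono.monotone.map_max, ← EReal.coe_add, EReal.coe_le_coe_iff]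
  simp only [oscQuotient]
  set n := dyadicLevel ε
  have hwn := oscSum_pos w n
  have hun := oscSum_pos u n
  have hvn := oscSum_pos v n
  rw [← (show Monotone fun x : ℝ => x / Real.log ε⁻¹ from
    fun a b hab => by simp only; gcongr).map_max, ← add_div]
  gcongr
  have hmax : 0 < max (oscSum u n) (oscSum v n) := lt_max_of_lt_left hun
  have h1 : oscSum w n ≤ max (oscSum u n) (oscSum v n) * 2 := by
    linarith [oscSum_le_add hu hv H n, le_max_left (oscSum u n) (oscSum v n),
      le_max_right (oscSum u n) (oscSum v n)]
  calc Real.log (oscSum w n) ≤ Real.log (max (oscSum u n) (oscSum v n) * 2) := by gcongr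
    _ = Real.log (max (oscSum u n) (oscSum v n)) + Real.log 2 :=
        Real.log_mul hmax.ne' (by norm_num)
    _ = _ := by
        congr 1
        exact Real.strictMonoOn_log.monotoneOn.map_max hun hvn

lemma upperMinkowskiDim_le_max {u v w : ℝ → ℝ} (hu : ContinuousOn u (Icc 0 1))
    (hv : ContinuousOn v (Icc 0 1)) (hw : ContinuousOn w (Icc 0 1))
    (H : ∀ s t, |w s - w t| ≤ |u s - u t| + |v s - v t|) :
    upperMinkowskiDim (planeGraph (Icc 0 1) w) ≤
      max (upperMinkowskiDim (planeGraph (Icc 0 1) u))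
        (upperMinkowskiDim (planeGraph (Icc 0 1) v)) := by
  rw [upperMinkowskiDim_eq hu, upperMinkowskiDim_eq hv, upperMinkowskiDim_eq hw, ← limsup_max]
  exact limsup_le_limsup_of_le_add (tendsto_const_div_log_inv _) (eventually_oscQuotient_le hu hv H)

/-- The lower dimension is only bounded with the upper dimension of one summand: the scales at which
the graphs of `u` and `v` are small need not be the same. -/
lemma lowerMinkowskiDim_le_max {u v w : ℝ → ℝ} (hu : ContinuousOn u (Icc 0 1))
    (hv : ContinuousOn v (Icc 0 1)) (hw : ContinuousOn w (Icc 0 1))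
    (H : ∀ s t, |w s - w t| ≤ |u s - u t| + |v s - v t|) :
    lowerMinkowskiDim (planeGraph (Icc 0 1) w) ≤
      max (upperMinkowskiDim (planeGraph (Icc 0 1) u))
        (lowerMinkowskiDim (planeGraph (Icc 0 1) v)) := by
  rw [upperMinkowskiDim_eq hu, lowerMinkowskiDim_eq hv, lowerMinkowskiDim_eq hw]
  exact (liminf_le_liminf_of_le_add (tendsto_const_div_log_inv _)
    (eventually_oscQuotient_le hu hv H)).trans (liminf_max_le _ _)

/-- The upper bounds come from the subadditivity of oscillation sums. So do the lower bounds,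
because `f` is itself the sum of `u + f` and `-u`, and the dimensions of the graph of `u` are
absorbed by those of the graph of `u + f`. -/
theorem minkowskiDim_add_eq_max {u f : ℝ → ℝ} (hu : ContinuousOn u (Icc 0 1))
    (hf : ContinuousOn f (Icc 0 1)) {a : EReal}
    (h1 : upperMinkowskiDim (planeGraph (Icc 0 1) u) ≤ a)
    (h2 : a ≤ lowerMinkowskiDim (planeGraph (Icc 0 1) u))
    (h3 : a ≤ lowerMinkowskiDim (planeGraph (Icc 0 1) fun t => u t + f t)) :
    lowerMinkowskiDim (planeGraph (Icc 0 1) fun t => u t + f t) =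
      max (lowerMinkowskiDim (planeGraph (Icc 0 1) u))
        (lowerMinkowskiDim (planeGraph (Icc 0 1) f)) ∧
    upperMinkowskiDim (planeGraph (Icc 0 1) fun t => u t + f t) =
      max (upperMinkowskiDim (planeGraph (Icc 0 1) u))
        (upperMinkowskiDim (planeGraph (Icc 0 1) f)) ∧
    upperMinkowskiDim (planeGraph (Icc 0 1) fun t => u t + f t) =
      max (lowerMinkowskiDim (planeGraph (Icc 0 1) u))
        (upperMinkowskiDim (planeGraph (Icc 0 1) f)) := by
  have hw : ContinuousOn (fun t => u t + f t) (Icc 0 1) := hu.add hf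
  have hlu := lowerMinkowskiDim_le_upperMinkowskiDim (planeGraph (Icc 0 1) u)
  have hup : upperMinkowskiDim (planeGraph (Icc 0 1) u) = a := le_antisymm h1 (h2.trans hlu)
  have hlo : lowerMinkowskiDim (planeGraph (Icc 0 1) u) = a := le_antisymm (hlu.trans h1) h2
  have H1 : ∀ s t, |(u s + f s) - (u t + f t)| ≤ |u s - u t| + |f s - f t| := fun s t => by
    rw [add_sub_add_comm]; exact abs_add_le _ _
  have H2 : ∀ s t, |f s - f t| ≤ |u s - u t| + |(u s + f s) - (u t + f t)| := fun s t => by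
    rw [show f s - f t = -(u s - u t) + ((u s + f s) - (u t + f t)) by ring, ← abs_neg (u s - u t)]
    exact abs_add_le _ _
  have h4 := h3.trans (lowerMinkowskiDim_le_upperMinkowskiDim _)
  have hU1 := upperMinkowskiDim_le_max hu hf hw H1
  have hU2 := upperMinkowskiDim_le_max hu hw hf H2
  have hL1 := lowerMinkowskiDim_le_max hu hf hw H1
  have hL2 := lowerMinkowskiDim_le_max hu hw hf H2
  rw [hup] at hU1 hU2 hL1 hL2
  rw [max_eq_right h4] at hU2
  rw [max_eq_right h3] at hL2
  rw [hup, hlo]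
  exact ⟨le_antisymm hL1 (max_le h3 hL2), le_antisymm hU1 (max_le h4 hU2),
    le_antisymm hU1 (max_le h4 hU2)⟩

lemma upperMinkowskiDim_le_of_oscSum_le {h : ℝ → ℝ} (hh : ContinuousOn h (Icc 0 1)) {a C : ℝ}
    (ha : 0 ≤ a) (hC : 0 < C) (H : ∀ᶠ n in atTop, oscSum h n ≤ C * ((2 : ℝ) ^ a) ^ n) :
    upperMinkowskiDim (planeGraph (Icc 0 1) h) ≤ (a : EReal) := by
  rw [upperMinkowskiDim_eq hh]
  calc _ ≤ limsup (fun _ : ℝ => (a : EReal)) (𝓝[>] 0) := by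
        refine limsup_le_limsup_of_le_add
          (tendsto_const_div_log_inv (Real.log C + a * Real.log 2)) ?_
        filter_upwards [eventually_small, tendsto_dyadicLevel.eventually H] with ε hε hn
        have hl := hε.2.2
        rw [← EReal.coe_add, EReal.coe_le_coe_iff, oscQuotient, div_le_iff₀ hl, add_mul,
          div_mul_cancel₀ _ hl.ne']
        have h1 : dyadicLevel ε * Real.log 2 ≤ Real.log 2 + Real.log ε⁻¹ := by
          rw [← Real.log_pow, ← Real.log_mul (by norm_num) (inv_pos.2 hε.1).ne']
          exact Real.log_le_log (by positivity) (two_pow_dyadicLevel_le hε.1 hε.2.1)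
        have h2 := Real.log_le_log (oscSum_pos h _) hn
        rw [Real.log_mul hC.ne' (by positivity), Real.log_pow, Real.log_rpow (by norm_num)] at h2
        nlinarith
    _ = a := limsup_const _

lemma le_lowerMinkowskiDim_of_le_oscSum {h : ℝ → ℝ} (hh : ContinuousOn h (Icc 0 1)) {a c : ℝ}
    (ha : 0 ≤ a) (hc : 0 < c) (H : ∀ᶠ n in atTop, c * ((2 : ℝ) ^ a) ^ n ≤ oscSum h n) :
    (a : EReal) ≤ lowerMinkowskiDim (planeGraph (Icc 0 1) h) := by
  rw [lowerMinkowskiDim_eq hh]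
  calc (a : EReal) = liminf (fun _ : ℝ => (a : EReal)) (𝓝[>] 0) := (liminf_const _).symm
    _ ≤ _ := by
        refine liminf_le_liminf_of_le_add (tendsto_const_div_log_inv (-Real.log c)) ?_
        filter_upwards [eventually_small, tendsto_dyadicLevel.eventually H] with ε hε hn
        have hl := hε.2.2
        rw [← EReal.coe_add, EReal.coe_le_coe_iff, oscQuotient, ← add_div, le_div_iff₀ hl]
        have h1 : Real.log ε⁻¹ ≤ dyadicLevel ε * Real.log 2 := by
          rw [← Real.log_pow]
          exact Real.log_le_log (inv_pos.2 hε.1) (inv_le_two_pow_dyadicLevel hε.1)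
        have h2 := Real.log_le_log (by positivity) hn
        rw [Real.log_mul hc.ne' (by positivity), Real.log_pow, Real.log_rpow (by norm_num)] at h2
        nlinarith

/-! ### Gaussian estimates -/

/-- The density of a centred Gaussian is bounded, so that the probability of an interval is bounded
by its length over the standard deviation, wherever the interval lies. -/
lemma gaussianReal_abs_add_lt_le {v : NNReal} (hv : v ≠ 0) (c δ : ℝ) :
    gaussianReal 0 v {x | |x + c| < δ} ≤ ENNReal.ofReal (δ / √v) := by
  have hv' : (0 : ℝ) < v := by positivity
  have hset : {x : ℝ | |x + c| < δ} = Metric.ball (-c) δ := by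
    ext x; simp [Real.dist_eq]
  have hpdf : ∀ x, gaussianPDF 0 v x ≤ ENNReal.ofReal (2 * √v)⁻¹ := fun x => by
    refine ENNReal.ofReal_le_ofReal ?_
    rw [gaussianPDFReal]
    have h1 : 2 * √(v : ℝ) ≤ √(2 * Real.pi * v) := by
      rw [Real.le_sqrt (by positivity) (by positivity), mul_pow, Real.sq_sqrt hv'.le]
      nlinarith [Real.pi_gt_three]
    have h2 : Real.exp (-(x - 0) ^ 2 / (2 * v)) ≤ 1 :=
      Real.exp_le_one_iff.2 (div_nonpos_of_nonpos_of_nonneg (by nlinarith [sq_nonneg (x - 0)])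
        (by positivity))
    calc _ ≤ (√(2 * Real.pi * v))⁻¹ * 1 := by gcongr
      _ ≤ (2 * √v)⁻¹ := by rw [mul_one]; gcongr
  rw [gaussianReal_apply 0 hv, hset]
  calc ∫⁻ x in Metric.ball (-c) δ, gaussianPDF 0 v x
      ≤ ∫⁻ _ in Metric.ball (-c) δ, ENNReal.ofReal (2 * √v)⁻¹ := lintegral_mono hpdf
    _ = ENNReal.ofReal (δ / √v) := by
        rw [setLIntegral_const, Real.volume_ball, ← ENNReal.ofReal_mul (by positivity)]
        congr 1
        field_simp

lemma gaussianReal_le_abs_le {v : NNReal} (hv : v ≠ 0) {a : ℝ} (ha : 0 ≤ a) :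
    gaussianReal 0 v {x | a ≤ |x|} ≤ ENNReal.ofReal (2 * Real.exp (-a ^ 2 / (2 * v))) := by
  have hv' : (0 : ℝ) < v := by positivity
  have hpos : (gaussianReal 0 v).real {x | a ≤ id x} ≤ Real.exp (-a ^ 2 / (2 * v)) := by
    have := measure_ge_le_exp_mul_mgf (μ := gaussianReal 0 v) (X := id) (t := a / v) a
      (by positivity) (integrable_exp_mul_gaussianReal _)
    rw [mgf_id_gaussianReal, ← Real.exp_add] at this
    refine this.trans_eq ?_
    congr 1
    field_simp
    ring
  have hneg : (gaussianReal 0 v).real {x | id x ≤ -a} ≤ Real.exp (-a ^ 2 / (2 * v)) := by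
    have := measure_le_le_exp_mul_mgf (μ := gaussianReal 0 v) (X := id) (t := -(a / v)) (-a)
      (by simp; positivity) (integrable_exp_mul_gaussianReal _)
    rw [mgf_id_gaussianReal, ← Real.exp_add] at this
    refine this.trans_eq ?_
    congr 1
    field_simp
    ring
  have hsub : {x : ℝ | a ≤ |x|} ⊆ {x | a ≤ id x} ∪ {x | id x ≤ -a} := fun x hx => by
    rcases le_abs.1 (show a ≤ |x| from hx) with h | h
    · exact .inl h
    · exact .inr (by simp only [id, mem_ofPred_eq]; linarith)
  rw [← ofReal_measureReal]
  refine ENNReal.ofReal_le_ofReal ?_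
  calc _ ≤ (gaussianReal 0 v).real ({x | a ≤ id x} ∪ {x | id x ≤ -a}) := measureReal_mono hsub
    _ ≤ _ := measureReal_union_le _ _
    _ ≤ _ := by linarith

/-! ### Brownian increments over dyadic intervals -/

section Increments

variable {Ω : Type*} {mΩ : MeasurableSpace Ω} {P : Measure Ω} {B : NNReal → Ω → ℝ}

/-- The increment of `B` over the dyadic interval `[i / 2ⁿ, (i + 1) / 2ⁿ]`. -/
noncomputable def dyadicIncrement (B : NNReal → Ω → ℝ) (n i : ℕ) (ω : Ω) : ℝ :=
  B (((i : ℝ) + 1) / 2 ^ n).toNNReal ω - B ((i : ℝ) / 2 ^ n).toNNReal ω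

lemma hasLaw_dyadicIncrement (hB : IsPreBrownianReal B P) (n i : ℕ) :
    HasLaw (dyadicIncrement B n i) (gaussianReal 0 ((2 : NNReal) ^ n)⁻¹) P := by
  have h := hB.hasLaw_sub (((i : ℝ) + 1) / 2 ^ n).toNNReal ((i : ℝ) / 2 ^ n).toNNReal
  have hv : nndist ((((i : ℝ) + 1) / 2 ^ n).toNNReal : ℝ) (((i : ℝ) / 2 ^ n).toNNReal : ℝ) =
      ((2 : NNReal) ^ n)⁻¹ := by
    ext
    rw [coe_nndist, Real.coe_toNNReal _ (by positivity), Real.coe_toNNReal _ (by positivity),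
      Real.dist_eq, ← sub_div, add_sub_cancel_left, abs_of_pos (by positivity)]
    simp
  rw [← hv]
  exact h

lemma measure_dyadicIncrement (hB : IsPreBrownianReal B P) (n i : ℕ) {s : Set ℝ}
    (hs : MeasurableSet s) :
    P (dyadicIncrement B n i ⁻¹' s) = gaussianReal 0 ((2 : NNReal) ^ n)⁻¹ s := by
  have h := hasLaw_dyadicIncrement hB n i
  rw [← h.map_eq, Measure.map_apply_of_aemeasurable h.aemeasurable hs]

/-- Markov's inequality for the number of events that occur: no independence is needed. -/
lemma measure_card_le_two_mul_count_le {ι : Type*} (F : Finset ι) (hF : F.Nonempty)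
    {S : ι → Set Ω} (hS : ∀ i, NullMeasurableSet (S i) P) {p : ENNReal} (hp : ∀ i, P (S i) ≤ p) :
    P {ω | (F.card : ENNReal) ≤ 2 * ∑ i ∈ F, (S i).indicator 1 ω} ≤ 2 * p := by
  have hmeas : ∀ i, AEMeasurable ((S i).indicator (1 : Ω → ENNReal)) P := fun i =>
    aemeasurable_one.indicator₀ (hS i)
  have hsum : AEMeasurable (fun ω => ∑ i ∈ F, (S i).indicator (1 : Ω → ENNReal) ω) P :=
    Finset.aemeasurable_fun_sum F fun i _ => hmeas i
  have h1 := mul_meas_ge_le_lintegral₀ (hsum.const_mul 2) (F.card : ENNReal)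
  rw [lintegral_const_mul'' 2 hsum, lintegral_finsetSum' F fun i _ => hmeas i] at h1
  have h2 : ∑ i ∈ F, ∫⁻ ω, (S i).indicator (1 : Ω → ENNReal) ω ∂P ≤ F.card * p := by
    rw [← nsmul_eq_mul]
    refine Finset.sum_le_card_nsmul _ _ _ fun i _ => ?_
    rw [lintegral_indicator_one₀ (hS i)]
    exact hp i
  have h3 : (F.card : ENNReal) * P {ω | (F.card : ENNReal) ≤ 2 * ∑ i ∈ F, (S i).indicator 1 ω} ≤
      F.card * (2 * p) :=
    h1.trans ((mul_le_mul_right h2 2).trans_eq (by ring))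
  exact (ENNReal.mul_le_mul_iff_right (by simpa using hF.ne_empty) (by simp)).1 h3

/-- If less than half of the members of a family have absolute value smaller than `δ`, then the sum
of the absolute values is at least `δ / 2` per member. -/
lemma half_card_mul_le_sum_abs {ι : Type*} (F : Finset ι) (x : ι → ℝ) {δ : ℝ}
    (hδ : 0 ≤ δ)
    (H : ¬ (F.card : ENNReal) ≤ 2 * ∑ i ∈ F, {i | |x i| < δ}.indicator 1 i) :
    F.card * δ / 2 ≤ ∑ i ∈ F, |x i| := by
  classical
  have hc : ∑ i ∈ F, {i | |x i| < δ}.indicator (1 : ι → ENNReal) i =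
      ((F.filter fun i => |x i| < δ).card : ENNReal) := by
    simp [Set.indicator_apply, Finset.sum_boole]
  rw [hc, not_le] at H
  have H' : 2 * (F.filter fun i => |x i| < δ).card < F.card := by exact_mod_cast H
  have hsplit := Finset.card_filter_add_card_filter_not (s := F) (fun i => |x i| < δ)
  have hcard : (F.card : ℝ) ≤ 2 * (F.filter fun i => ¬ |x i| < δ).card := by
    exact_mod_cast (by omega : F.card ≤ 2 * (F.filter fun i => ¬ |x i| < δ).card)
  calc F.card * δ / 2 ≤ (F.filter fun i => ¬ |x i| < δ).card * δ := by nlinarith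
    _ = (F.filter fun i => ¬ |x i| < δ).card • δ := (nsmul_eq_mul _ _).symm
    _ ≤ ∑ i ∈ F.filter (fun i => ¬ |x i| < δ), |x i| :=
        Finset.card_nsmul_le_sum _ _ _ fun i hi => not_lt.1 (Finset.mem_filter.1 hi).2
    _ ≤ ∑ i ∈ F, |x i| :=
        Finset.sum_le_sum_of_subset_of_nonneg (Finset.filter_subset _ _) fun _ _ _ => abs_nonneg _

/-- An increment of `B + f` over a dyadic interval of level `n` is smaller than
`2 ^ (-(1 / 2 + η) n)` with probability at most `2 ^ (-η n)`, which is summable, so that almost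
surely less than half of the increments are that small once `n` is large. -/
lemma ae_eventually_le_sum_abs_dyadicIncrement (hB : IsPreBrownianReal B P) (f : ℝ → ℝ) {η : ℝ}
    (hη : 0 < η) :
    ∀ᵐ ω ∂P, ∀ᶠ n : ℕ in atTop, 2 ^ n * ((2 : ℝ) ^ (-(1 / 2 + η))) ^ n / 2 ≤
      ∑ i ∈ Finset.range (2 ^ n), |dyadicIncrement B n i ω +
        (f (((i : ℝ) + 1) / 2 ^ n) - f ((i : ℝ) / 2 ^ n))| := by
  set q : ℝ := 2 ^ (-η) with hq
  have hq0 : 0 < q := by positivity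
  have hq1 : q < 1 := Real.rpow_lt_one_of_one_lt_of_neg one_lt_two (by linarith)
  let c : ℕ → ℕ → ℝ := fun n i => f (((i : ℝ) + 1) / 2 ^ n) - f ((i : ℝ) / 2 ^ n)
  let δ : ℕ → ℝ := fun n => ((2 : ℝ) ^ (-(1 / 2 + η))) ^ n
  have hδ : ∀ n, 0 ≤ δ n := fun n => by positivity
  let S : ℕ → ℕ → Set Ω := fun n i => dyadicIncrement B n i ⁻¹' {x | |x + c n i| < δ n}
  have hmeas : ∀ n i, MeasurableSet {x : ℝ | |x + c n i| < δ n} := fun n i =>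
    measurableSet_lt (by fun_prop) measurable_const
  have hS : ∀ n i, NullMeasurableSet (S n i) P := fun n i =>
    (hasLaw_dyadicIncrement hB n i).aemeasurable.nullMeasurable (hmeas n i)
  have hprob : ∀ n i, P (S n i) ≤ ENNReal.ofReal (q ^ n) := fun n i => by
    rw [measure_dyadicIncrement hB n i (hmeas n i)]
    refine (gaussianReal_abs_add_lt_le (by positivity) _ _).trans
      (ENNReal.ofReal_le_ofReal (le_of_eq ?_))
    have hsq : √((((2 : NNReal) ^ n)⁻¹ : NNReal) : ℝ) = ((2 : ℝ) ^ (-(1 / 2) : ℝ)) ^ n := by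
      rw [Real.sqrt_eq_iff_eq_sq (by positivity) (by positivity), ← pow_mul, mul_comm, pow_mul,
        ← Real.rpow_natCast (2 ^ (-(1 / 2) : ℝ)) 2, ← Real.rpow_mul (by norm_num)]
      norm_num
      rw [one_div, inv_pow]
    rw [hsq, ← div_pow, ← Real.rpow_sub (by norm_num)]
    congr 2
    ring
  have hsum : ∑' n, P {ω | ((Finset.range (2 ^ n)).card : ENNReal) ≤
      2 * ∑ i ∈ Finset.range (2 ^ n), (S n i).indicator 1 ω} ≠ ⊤ := by
    refine ne_top_of_le_ne_top ?_ (ENNReal.tsum_le_tsum fun n =>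
      measure_card_le_two_mul_count_le (Finset.range (2 ^ n)) (by simp) (hS n) (hprob n))
    rw [ENNReal.tsum_mul_left]
    exact ENNReal.mul_ne_top (by simp)
      (summable_geometric_of_lt_one hq0.le hq1).tsum_ofReal_ne_top
  filter_upwards [ae_eventually_notMem hsum] with ω hω
  filter_upwards [hω] with n hn
  have := half_card_mul_le_sum_abs (Finset.range (2 ^ n))
    (fun i => dyadicIncrement B n i ω + c n i) (hδ n) hn
  rw [Finset.card_range] at this
  push_cast at this
  exact this

lemma summable_two_pow_mul_exp_neg_pow {x : ℝ} (hx : 1 < x) :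
    Summable fun n : ℕ => (2 : ℝ) ^ n * (2 * Real.exp (-x ^ n / 2)) := by
  have hlim := tendsto_pow_const_div_const_pow_of_one_lt 1 hx
  have hev : ∀ᶠ n : ℕ in atTop, (n : ℝ) ≤ x ^ n / 2 := by
    filter_upwards [hlim.eventually (gt_mem_nhds (by norm_num : (0 : ℝ) < 1 / 2))] with n hn
    rw [pow_one, div_lt_iff₀ (by positivity)] at hn
    linarith
  have hr : 2 * Real.exp (-1) < 1 := by
    have := Real.exp_one_gt_d9
    rw [Real.exp_neg, ← div_eq_mul_inv, div_lt_one (Real.exp_pos 1)]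
    linarith
  refine Summable.of_norm_bounded_eventually_nat
    ((summable_geometric_of_lt_one (by positivity) hr).mul_left 2) ?_
  filter_upwards [hev] with n hn
  rw [Real.norm_of_nonneg (by positivity), mul_pow, ← Real.exp_nat_mul]
  have : Real.exp (-x ^ n / 2) ≤ Real.exp (n * -1) := Real.exp_le_exp.2 (by linarith)
  calc (2 : ℝ) ^ n * (2 * Real.exp (-x ^ n / 2)) ≤ 2 ^ n * (2 * Real.exp (n * -1)) := by gcongr
    _ = _ := by ring

/-- A union bound over the `2ⁿ` dyadic intervals of level `n`: the Gaussian tail at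
`2 ^ (η n)` standard deviations is small enough for the bounds to be summable. -/
lemma ae_eventually_abs_dyadicIncrement_le (hB : IsPreBrownianReal B P) {η : ℝ} (hη : 0 < η) :
    ∀ᵐ ω ∂P, ∀ᶠ n : ℕ in atTop, ∀ i < 2 ^ n,
      |dyadicIncrement B n i ω| ≤ ((2 : ℝ) ^ (η - 1 / 2)) ^ n := by
  let a : ℕ → ℝ := fun n => ((2 : ℝ) ^ (η - 1 / 2)) ^ n
  have ha : ∀ n, 0 ≤ a n := fun n => by positivity
  set x : ℝ := 2 ^ (2 * η) with hx
  have hx1 : 1 < x := Real.one_lt_rpow one_lt_two (by linarith)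
  have hax : ∀ n, -a n ^ 2 / (2 * ((((2 : NNReal) ^ n)⁻¹ : NNReal) : ℝ)) = -x ^ n / 2 := fun n => by
    have h2 : a n ^ 2 * 2 ^ n = x ^ n := by
      simp only [a]
      rw [← pow_mul, mul_comm n 2, pow_mul, ← mul_pow, hx]
      congr 1
      rw [← Real.rpow_natCast (2 ^ (η - 1 / 2) : ℝ) 2, ← Real.rpow_mul (by norm_num),
        ← Real.rpow_add_one (by norm_num)]
      congr 1
      push_cast
      ring
    rw [← h2]
    push_cast
    field_simp
  have hbound : ∀ n, P (⋃ i ∈ Finset.range (2 ^ n), dyadicIncrement B n i ⁻¹' {y | a n ≤ |y|}) ≤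
      ENNReal.ofReal (2 ^ n * (2 * Real.exp (-x ^ n / 2))) := fun n => by
    refine (measure_biUnion_finset_le _ _).trans ?_
    refine (Finset.sum_le_card_nsmul _ _ (ENNReal.ofReal (2 * Real.exp (-x ^ n / 2)))
      fun i _ => ?_).trans_eq ?_
    · rw [measure_dyadicIncrement hB n i (measurableSet_le measurable_const (by fun_prop)), ← hax n]
      exact gaussianReal_le_abs_le (by positivity) (ha n)
    · rw [ENNReal.ofReal_mul (p := 2 ^ n) (by positivity), nsmul_eq_mul, Finset.card_range,
        ENNReal.ofReal_pow (by norm_num)]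
      simp
  have hsum := ne_top_of_le_ne_top (summable_two_pow_mul_exp_neg_pow hx1).tsum_ofReal_ne_top
    (ENNReal.tsum_le_tsum hbound)
  filter_upwards [ae_eventually_notMem hsum] with ω hω
  filter_upwards [hω] with n hn i hi
  by_contra! hlt
  exact hn (mem_iUnion₂.2 ⟨i, Finset.mem_range.2 hi, hlt.le⟩)

end Increments

/-! ### Dimensions of the graph of Brownian motion with drift -/

section Brownian

variable {Ω : Type*} {mΩ : MeasurableSpace Ω} {P : Measure Ω} {B : NNReal → Ω → ℝ}

lemma continuousOn_path {ω : Ω} (h : Continuous fun t => B t ω) :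
    ContinuousOn (fun t : ℝ => B t.toNNReal ω) (Icc 0 1) :=
  (h.comp continuous_real_toNNReal).continuousOn

lemma tendsto_one_div_add_three : Tendsto (fun k : ℕ => 1 / ((k : ℝ) + 3)) atTop (𝓝 0) :=
  tendsto_const_nhds.div_atTop (tendsto_atTop_add_const_right _ _ tendsto_natCast_atTop_atTop)

lemma one_div_add_three_lt_half (k : ℕ) : 1 / ((k : ℝ) + 3) < 1 / 2 :=
  one_div_lt_one_div_of_lt two_pos (by linarith [(Nat.cast_nonneg k : (0 : ℝ) ≤ k)])

theorem ae_upperMinkowskiDim_brownian_le (hB : IsBrownianReal B P) :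
    ∀ᵐ ω ∂P, upperMinkowskiDim (planeGraph (Icc 0 1) fun t => B t.toNNReal ω) ≤
      ((3 / 2 : ℝ) : EReal) := by
  have hη : ∀ k : ℕ, 0 < 1 / ((k : ℝ) + 3) := fun k => by positivity
  filter_upwards [hB.cont, ae_all_iff.2 fun k : ℕ =>
    ae_eventually_abs_dyadicIncrement_le hB.toIsPreBrownianReal (hη k)] with ω hc hω
  have hcont := continuousOn_path hc
  have hk : ∀ k : ℕ, upperMinkowskiDim (planeGraph (Icc 0 1) fun t => B t.toNNReal ω) ≤
      ((3 / 2 + 1 / ((k : ℝ) + 3) : ℝ) : EReal) := by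
    intro k
    set η := 1 / ((k : ℝ) + 3)
    -- `η < 1 / 2` makes the series of the chaining argument converge
    set r : ℝ := 2 ^ (η - 1 / 2) with hr
    have hr1 : r < 1 := Real.rpow_lt_one_of_one_lt_of_neg one_lt_two
      (by linarith [one_div_add_three_lt_half k])
    have hr0 : 1 / 2 ≤ r := by
      rw [one_div, ← Real.rpow_neg_one]
      exact Real.rpow_le_rpow_of_exponent_le one_le_two (by linarith [hη k])
    have h4r : 4 * r = 2 ^ (3 / 2 + η) := by
      rw [show (4 : ℝ) = 2 ^ (2 : ℝ) by norm_num, hr, ← Real.rpow_add two_pos]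
      congr 1
      ring
    have h1r : 0 < 1 - r := by linarith
    refine upperMinkowskiDim_le_of_oscSum_le hcont (by linarith [hη k])
      (C := 1 + 2 / (1 - r)) (by positivity) ?_
    rw [← h4r]
    filter_upwards [eventually_forall_ge_atTop.2 (hω k)] with n hn
    exact oscSum_le_of_dyadic_increments hcont hr0 hr1 hn
  have hlim : Tendsto (fun k : ℕ => ((3 / 2 + 1 / ((k : ℝ) + 3) : ℝ) : EReal)) atTop
      (𝓝 ((3 / 2 : ℝ) : EReal)) :=
    (continuous_coe_real_ereal.tendsto _).comp
      (by simpa using tendsto_one_div_add_three.const_add (3 / 2))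
  exact ge_of_tendsto' hlim hk

theorem ae_le_lowerMinkowskiDim_brownian_add (hB : IsBrownianReal B P) {f : ℝ → ℝ}
    (hf : ContinuousOn f (Icc 0 1)) :
    ∀ᵐ ω ∂P, ((3 / 2 : ℝ) : EReal) ≤
      lowerMinkowskiDim (planeGraph (Icc 0 1) fun t => B t.toNNReal ω + f t) := by
  have hη : ∀ k : ℕ, 0 < 1 / ((k : ℝ) + 3) := fun k => by positivity
  filter_upwards [hB.cont, ae_all_iff.2 fun k : ℕ =>
    ae_eventually_le_sum_abs_dyadicIncrement hB.toIsPreBrownianReal f (hη k)] with ω hc hω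
  have hcont : ContinuousOn (fun t : ℝ => B t.toNNReal ω + f t) (Icc 0 1) :=
    (continuousOn_path hc).add hf
  have hk : ∀ k : ℕ, ((3 / 2 - 1 / ((k : ℝ) + 3) : ℝ) : EReal) ≤
      lowerMinkowskiDim (planeGraph (Icc 0 1) fun t => B t.toNNReal ω + f t) := by
    intro k
    set η := 1 / ((k : ℝ) + 3)
    refine le_lowerMinkowskiDim_of_le_oscSum hcont
      (by linarith [one_div_add_three_lt_half k]) (c := 1 / 2) (by norm_num) ?_
    filter_upwards [hω k] with n hn
    have h4 : (2 : ℝ) ^ (3 / 2 - η) = 2 * 2 * 2 ^ (-(1 / 2 + η)) := by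
      rw [show (2 : ℝ) * 2 = 2 ^ (2 : ℝ) by norm_num, ← Real.rpow_add two_pos]
      congr 1
      ring
    calc 1 / 2 * ((2 : ℝ) ^ (3 / 2 - η)) ^ n
        = 2 ^ n * (2 ^ n * ((2 : ℝ) ^ (-(1 / 2 + η))) ^ n / 2) := by
          rw [h4, mul_pow, mul_pow]; ring
      _ ≤ _ := by
          refine (mul_le_mul_of_nonneg_left hn (by positivity)).trans ?_
          refine le_trans (le_of_eq ?_) (sum_abs_increments_le_oscSum hcont n)
          congr 1
          refine Finset.sum_congr rfl fun i _ => ?_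
          rw [dyadicIncrement]
          congr 1
          ring
  have hlim : Tendsto (fun k : ℕ => ((3 / 2 - 1 / ((k : ℝ) + 3) : ℝ) : EReal)) atTop
      (𝓝 ((3 / 2 : ℝ) : EReal)) :=
    (continuous_coe_real_ereal.tendsto _).comp
      (by simpa using tendsto_one_div_add_three.const_sub (3 / 2))
  exact le_of_tendsto' hlim hk

end Brownian

/-- `B` is a standard one-dimensional Brownian motion under `P`, indexed by `ℝ≥0`. Only the values
of `f` and of the paths of `B` on `[0, 1]` matter, where `t.toNNReal` is `t`. -/
theorem mainTheorem3 {Ω : Type*} {mΩ : MeasurableSpace Ω} (P : Measure Ω)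
    (B : NNReal → Ω → ℝ) (hB : IsBrownianReal B P)
    (f : ℝ → ℝ) (hf : ContinuousOn f (Icc 0 1)) :
    ∀ᵐ ω ∂P,
      lowerMinkowskiDim (planeGraph (Icc 0 1) fun t => B t.toNNReal ω + f t) =
        max (lowerMinkowskiDim (planeGraph (Icc 0 1) fun t => B t.toNNReal ω))
          (lowerMinkowskiDim (planeGraph (Icc 0 1) f)) ∧
      upperMinkowskiDim (planeGraph (Icc 0 1) fun t => B t.toNNReal ω + f t) =
        max (upperMinkowskiDim (planeGraph (Icc 0 1) fun t => B t.toNNReal ω))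
          (upperMinkowskiDim (planeGraph (Icc 0 1) f)) ∧
      upperMinkowskiDim (planeGraph (Icc 0 1) fun t => B t.toNNReal ω + f t) =
        max (lowerMinkowskiDim (planeGraph (Icc 0 1) fun t => B t.toNNReal ω))
          (upperMinkowskiDim (planeGraph (Icc 0 1) f)) := by
  filter_upwards [hB.cont, ae_upperMinkowskiDim_brownian_le hB,
    ae_le_lowerMinkowskiDim_brownian_add hB (f := fun _ => 0) continuousOn_const,
    ae_le_lowerMinkowskiDim_brownian_add hB hf] with ω hc h1 h2 h3
  simp only [add_zero] at h2
  exact minkowskiDim_add_eq_max (continuousOn_path hc) hf h1 h2 h3
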